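/- Two intersecting circles in the plane are said to intersect at angle $\theta$ if at every common point of the two circles the (smaller) angle between their tangent lines at that point equals $\theta$. For a collection $\mathcal{C}$ of circles (of positive radius) in the plane, the $\theta$-graph $G_\theta(\mathcal{C})$ is the graph with vertex set $\mathcal{C}$ whose edges are the pairs of distinct circles in $\mathcal{C}$ that intersect at angle $\theta$. Theorem. For every $\theta\in(0,\pi/2]$ and all integers $g\geq 3$ and $k\geq 1$, there is a finite collection $\mathcal{C}$ of circles in the plane, no two of them concentric, such that the $\theta$-graph $G_\theta(\mathcal{C})$ has girth at least $g$ and chromatic number at least $k$. (The girth of a graph is the minimum length of a cycle, and is $\infty$ if the graph has no cycle.) -/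

import Mathlib

/-- The Euclidean plane. -/
abbrev Plane : Type := EuclideanSpace ℝ (Fin 2)

/-- The (smaller) angle between two lines: the least angle formed by nonzero direction vectors of
the two lines. For lines with direction vectors `u`, `v`, the angles that occur are
`InnerProductGeometry.angle u v` and `π - InnerProductGeometry.angle u v`. -/
noncomputable def lineAngle (L₁ L₂ : AffineSubspace ℝ Plane) : ℝ :=
  sInf {α : ℝ | ∃ u ∈ L₁.direction, ∃ v ∈ L₂.direction,
    u ≠ 0 ∧ v ≠ 0 ∧ α = InnerProductGeometry.angle u v}

/-- Two circles intersect at angle `θ`: they have a common point, and at every common point `p` the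
(smaller) angle between their tangent lines at `p` equals `θ`. For a circle `C` of positive radius
and a point `p` on it, `C.orthRadius p` is the tangent line to `C` at `p`, i.e. the line through
`p` orthogonal to the radius. -/
def IntersectAtAngle (θ : ℝ) (C₁ C₂ : EuclideanGeometry.Sphere Plane) : Prop :=
  (∃ p : Plane, p ∈ C₁ ∧ p ∈ C₂) ∧
    ∀ p : Plane, p ∈ C₁ → p ∈ C₂ → lineAngle (C₁.orthRadius p) (C₂.orthRadius p) = θ

theorem lineAngle_comm (L₁ L₂ : AffineSubspace ℝ Plane) : lineAngle L₁ L₂ = lineAngle L₂ L₁ := by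
  unfold lineAngle
  congr 1
  ext α
  constructor <;>
  · rintro ⟨u, hu, v, hv, hu0, hv0, h⟩
    exact ⟨v, hv, u, hu, hv0, hu0, h.trans (InnerProductGeometry.angle_comm u v)⟩

theorem IntersectAtAngle.symm {θ : ℝ} {C₁ C₂ : EuclideanGeometry.Sphere Plane}
    (h : IntersectAtAngle θ C₁ C₂) : IntersectAtAngle θ C₂ C₁ := by
  obtain ⟨⟨p, hp₁, hp₂⟩, h⟩ := h
  exact ⟨⟨p, hp₂, hp₁⟩, fun q hq₂ hq₁ => (lineAngle_comm _ _).trans (h q hq₁ hq₂)⟩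

/-- The `θ`-graph of a collection `𝒞` of circles: the vertices are the circles in `𝒞`, and the edges
are the pairs of (distinct) circles in `𝒞` that intersect at angle `θ`. -/
def thetaGraph (θ : ℝ) (𝒞 : Set (EuclideanGeometry.Sphere Plane)) : SimpleGraph 𝒞 where
  Adj C₁ C₂ := C₁ ≠ C₂ ∧ IntersectAtAngle θ C₁.1 C₂.1
  symm := ⟨fun _ _ h => ⟨h.1.symm, h.2.symm⟩⟩
  loopless := ⟨fun _ h => h.1 rfl⟩

/-! The proof is by induction on the number of colours. Put c = cos θ. A vertical line meets the
circle with centre (x, y) and radius r at angle θ exactly when its abscissa is x ± c r. Let X be the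
set of these abscissas for a system of circles that is not k-colourable. Gallai's theorem gives
finitely many homothetic copies of X, one of which is monochromatic in every (k+1)-colouring of the
line. Over each copy of X draw the correspondingly scaled copy of the system, at its own height, and
draw the vertical lines through all points used. In a (k+1)-colouring, the circles over a
monochromatic copy of X avoid the colour of its lines, so the old system would be k-colourable.
Inversion at a generic centre (`exists_generic_inversion`) preserves angles and turns the lines into
circles.

For the girth, a line is joined to at most one circle of each copy. A short cycle therefore lies
inside one copy or yields a short Berge cycle among the copies of X. The latter is excluded by
`sparseGallai`, a Gallai theorem without short cycles, proved by a partite construction with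
induction on the cycle length. Absence of cycles is encoded by ears, the analogue of the two leaves
of a tree, because this condition passes through gluing (`TwoEars.amalgam`). -/

open Filter EuclideanGeometry

/-! ### Ears and amalgams of set families -/

/-- The member `e` of the family `s` shares at most one point with the union of the other members
listed in `F`. -/
def IsEar {J V : Type*} (s : J → Set V) (F : Finset J) (e : J) : Prop :=
  ∀ p ∈ s e, ∀ q ∈ s e, (∃ f ∈ F, f ≠ e ∧ p ∈ s f) → (∃ f ∈ F, f ≠ e ∧ q ∈ s f) → p = q

/-- At least two members of the subfamily `F` are ears. -/
def TwoEars {J V : Type*} (s : J → Set V) (F : Finset J) : Prop :=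
  ∃ e ∈ F, ∃ f ∈ F, e ≠ f ∧ IsEar s F e ∧ IsEar s F f

/-- Every subfamily with at least two and fewer than `m` members has two ears; equivalently, the
hypergraph `s` has no Berge cycle of length less than `m`. -/
def SparseFamily {J V : Type*} (m : ℕ) (s : J → Set V) : Prop :=
  ∀ F : Finset J, 2 ≤ F.card → F.card < m → TwoEars s F

theorem IsEar.of_subsingleton {J V : Type*} {s : J → Set V} {F : Finset J} {e : J}
    (T : Set V) (hT : T.Subsingleton) (h : ∀ p ∈ s e, ∀ f ∈ F, f ≠ e → p ∈ s f → p ∈ T) :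
    IsEar s F e := by
  rintro p hp q hq ⟨f, hf, hfe, hpf⟩ ⟨f', hf', hfe', hqf⟩
  exact hT (h p hp f hf hfe hpf) (h q hq f' hf' hfe' hqf)

theorem TwoEars.of_forall {J V : Type*} {s : J → Set V} {F : Finset J} (hF : 2 ≤ F.card)
    (h : ∀ e ∈ F, IsEar s F e) : TwoEars s F := by
  obtain ⟨e, he, f, hf, hef⟩ := Finset.one_lt_card.1 hF
  exact ⟨e, he, f, hf, hef, h e he, h f hf⟩

theorem TwoEars.image {J J' V V' : Type*} [DecidableEq J'] {s : J → Set V} {s' : J' → Set V'}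
    {F : Finset J} (i : J → J') (hi : Set.InjOn i F) (f : V → V')
    (hf : ∀ e ∈ F, ∀ e' ∈ F, ∀ p ∈ s e, ∀ q ∈ s e', f p = f q → p = q)
    (hs : ∀ e ∈ F, s' (i e) = f '' s e) (h : TwoEars s F) : TwoEars s' (F.image i) := by
  have key : ∀ e ∈ F, IsEar s F e → IsEar s' (F.image i) (i e) := by
    intro e he hear p' hp' q' hq' h1 h2
    rw [hs e he] at hp' hq'
    obtain ⟨p, hp, rfl⟩ := hp'
    obtain ⟨q, hq, rfl⟩ := hq'
    have aux : ∀ p ∈ s e, (∃ g ∈ F.image i, g ≠ i e ∧ f p ∈ s' g) →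
        ∃ g ∈ F, g ≠ e ∧ p ∈ s g := by
      rintro p hp ⟨g', hg', hne, hpg⟩
      obtain ⟨g, hg, rfl⟩ := Finset.mem_image.1 hg'
      rw [hs g hg] at hpg
      obtain ⟨r, hr, hrp⟩ := hpg
      refine ⟨g, hg, fun h => hne (h ▸ rfl), ?_⟩
      rwa [← hf g hg e he r hr p hp hrp]
    rw [hear p hp q hq (aux p hp h1) (aux q hq h2)]
  obtain ⟨e, he, g, hg, hne, h1, h2⟩ := h
  exact ⟨i e, Finset.mem_image_of_mem _ he, i g, Finset.mem_image_of_mem _ hg,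
    fun h => hne (hi he hg h), key e he h1, key g hg h2⟩

theorem TwoEars.map_points {J V V' : Type*} {s : J → Set V} {s' : J → Set V'}
    {F : Finset J} (f : V → V')
    (hf : ∀ e ∈ F, ∀ e' ∈ F, ∀ p ∈ s e, ∀ q ∈ s e', f p = f q → p = q)
    (hs : ∀ e ∈ F, s' e = f '' s e) (h : TwoEars s F) : TwoEars s' F := by
  classical
  have := TwoEars.image (s' := s') id Function.injective_id.injOn f hf hs h
  rwa [Finset.image_id] at this

/-- Gluing families along the sets `t i`: an amalgam of families with two ears over a family `t`
with two ears has two ears. -/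
theorem TwoEars.amalgam {J I V : Type*} [DecidableEq I] {s : J → Set V} {F : Finset J}
    (κ : J → I) (t : I → Set V) (hF : 2 ≤ F.card)
    (hst : ∀ e ∈ F, ∀ f ∈ F, κ e ≠ κ f → ∀ p ∈ s e, p ∈ s f → p ∈ t (κ e))
    (hfib : ∀ i, ∀ F' ⊆ F, (∀ e ∈ F', κ e = i) → 2 ≤ F'.card → TwoEars s F')
    (hbase : 2 ≤ (F.image κ).card → TwoEars t (F.image κ)) : TwoEars s F := by
  by_cases hI : 2 ≤ (F.image κ).card
  · have key : ∀ i ∈ F.image κ, IsEar t (F.image κ) i → ∃ e ∈ F, κ e = i ∧ IsEar s F e := by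
      intro i hi hear
      -- The fibre over an ear `i` communicates with the other fibres through at most one point.
      let Q : Set V := {p | p ∈ t i ∧ ∃ j ∈ F.image κ, j ≠ i ∧ p ∈ t j}
      have hQ : Q.Subsingleton := fun p hp q hq => hear p hp.1 q hq.1 hp.2 hq.2
      have hout : ∀ e ∈ F, κ e = i → ∀ f ∈ F, κ f ≠ i → ∀ p ∈ s e, p ∈ s f → p ∈ Q := by
        rintro e he rfl f hf hfe p hpe hpf
        exact ⟨hst e he f hf hfe.symm p hpe hpf, κ f, Finset.mem_image_of_mem _ hf, hfe,
          hst f hf e he hfe p hpf hpe⟩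
      obtain ⟨e₀, he₀, he₀i⟩ := Finset.mem_image.1 hi
      by_cases hc : 2 ≤ (F.filter (fun e => κ e = i)).card
      · obtain ⟨e, he, f, hf, hef, hearE, hearF⟩ :=
          hfib i _ (Finset.filter_subset _ _) (fun e he => (Finset.mem_filter.1 he).2) hc
        have he' := Finset.mem_filter.1 he
        have hf' := Finset.mem_filter.1 hf
        have main : ∀ e ∈ F, κ e = i → IsEar s (F.filter (fun e => κ e = i)) e →
            (∀ q ∈ Q, q ∉ s e) → IsEar s F e := by
          intro e he hei hear hno p hp q hq h1 h2
          have aux : ∀ p ∈ s e, (∃ f ∈ F, f ≠ e ∧ p ∈ s f) →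
              ∃ f ∈ F.filter (fun e => κ e = i), f ≠ e ∧ p ∈ s f := by
            rintro p hp ⟨f, hf, hfe, hpf⟩
            refine ⟨f, Finset.mem_filter.2 ⟨hf, ?_⟩, hfe, hpf⟩
            by_contra hk
            exact hno p (hout e he hei f hf hk p hp hpf) hp
          exact hear p hp q hq (aux p hp h1) (aux q hq h2)
        by_cases h1 : ∀ q ∈ Q, q ∉ s e
        · exact ⟨e, he'.1, he'.2, main e he'.1 he'.2 hearE h1⟩
        by_cases h2 : ∀ q ∈ Q, q ∉ s f
        · exact ⟨f, hf'.1, hf'.2, main f hf'.1 hf'.2 hearF h2⟩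
        push Not at h1 h2
        obtain ⟨q, hqQ, hqe⟩ := h1
        obtain ⟨q', hqQ', hqf⟩ := h2
        obtain rfl := hQ hqQ hqQ'
        -- Both ears of the fibre contain the only point `q` of `Q`. So `e` already meets its own
        -- fibre at `q`, hence only there, and the outside adds no other point.
        refine ⟨e, he'.1, he'.2, IsEar.of_subsingleton {q} Set.subsingleton_singleton ?_⟩
        intro p hp g hg hge hpg
        by_cases hgi : κ g = i
        · exact hearE p hp q hqe ⟨g, Finset.mem_filter.2 ⟨hg, hgi⟩, hge, hpg⟩ ⟨f, hf, hef.symm, hqf⟩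
        · exact hQ (hout e he'.1 he'.2 g hg hgi p hp hpg) hqQ
      · refine ⟨e₀, he₀, he₀i, IsEar.of_subsingleton Q hQ ?_⟩
        intro p hp f hf hfe hpf
        refine hout e₀ he₀ he₀i f hf (fun hfi => hc ?_) p hp hpf
        exact Finset.one_lt_card.2 ⟨f, Finset.mem_filter.2 ⟨hf, hfi⟩, e₀,
          Finset.mem_filter.2 ⟨he₀, he₀i⟩, hfe⟩
    obtain ⟨i, hi, j, hj, hij, h1, h2⟩ := hbase hI
    obtain ⟨e, he, rfl, hee⟩ := key i hi h1
    obtain ⟨f, hf, rfl, hff⟩ := key j hj h2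
    exact ⟨e, he, f, hf, fun h => hij (h ▸ rfl), hee, hff⟩
  · obtain ⟨e₀, he₀⟩ : F.Nonempty := Finset.card_pos.1 (by omega)
    refine hfib (κ e₀) F subset_rfl (fun e he => ?_) hF
    by_contra hne
    exact hI (Finset.one_lt_card.2 ⟨κ e, Finset.mem_image_of_mem _ he, κ e₀,
      Finset.mem_image_of_mem _ he₀, hne⟩)

/-! ### A sparse Gallai theorem on the line -/

/-- Gallai's theorem on the line, in a finitary form: finitely many homothetic copies of `X` suffice
to have a monochromatic one in every colouring. -/
theorem exists_finite_gallai (X : Finset ℝ) (k : ℕ) :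
    ∃ (J : Type) (_ : Fintype J) (b l : J → ℝ), (∀ j, l j ≠ 0) ∧
      ∀ c : ℝ → Fin k, ∃ j κ, ∀ x ∈ X, c (b j + l j * x) = κ := by
  classical
  -- Hales–Jewett over the alphabet `X`: summing coordinates sends a combinatorial line to b + l x,
  -- where l counts the moving coordinates and b is the sum of the fixed ones.
  obtain ⟨ι, _, h⟩ := Combinatorics.Line.exists_mono_in_high_dimension X (Fin k)
  refine ⟨{f : ι → Option X // ∃ i, f i = none}, inferInstance,
    fun f => ∑ i, (f.1 i).elim 0 (fun x => (x : ℝ)),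
    fun f => ∑ i, (f.1 i).elim 1 (fun _ => (0 : ℝ)), ?_, ?_⟩
  · rintro ⟨f, i, hi⟩
    refine ne_of_gt (Finset.sum_pos' (fun i _ => ?_) ⟨i, Finset.mem_univ _, by simp [hi]⟩)
    dsimp only
    rcases f i with _ | _ <;> simp
  · intro c
    obtain ⟨l, κ, hl⟩ := h (fun w => c (∑ i, (w i : ℝ)))
    refine ⟨⟨l.idxFun, l.proper⟩, κ, fun x hx => ?_⟩
    rw [← hl ⟨x, hx⟩, Finset.sum_mul, ← Finset.sum_add_distrib]
    congr 1
    refine Finset.sum_congr rfl fun i _ => ?_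
    simp only [Combinatorics.Line.coe_apply]
    cases l.idxFun i <;> simp

theorem eventually_cofinite_linear_ne {a b : ℝ} (h : a ≠ 0 ∨ b ≠ 0) :
    ∀ᶠ t in cofinite, a * t + b ≠ 0 := by
  have : {t : ℝ | a * t + b = 0}.Subsingleton := by
    intro s hs t ht
    simp only [Set.mem_ofPred_eq] at hs ht
    rcases eq_or_ne a 0 with rfl | ha
    · exact absurd (by linarith) (h.resolve_left (by simp))
    · exact mul_left_cancel₀ ha (by linarith)
  simpa [Filter.eventually_cofinite] using this.finite

/-- Taking t h = s n_h with distinct integers n_h makes each forbidden coincidence a nonconstant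
linear equation in s, so only finitely many s are excluded. -/
theorem exists_generic_shift {H P : Type*} [Finite H] [Finite P] (β : H → P → ℝ) (v : P → ℝ) :
    ∃ t : H → ℝ, ∀ h h', h ≠ h' → ∀ p p', v p = v p' → v p ≠ 0 →
      β h p + v p * t h ≠ β h' p' + v p' * t h' := by
  obtain ⟨n, ⟨e⟩⟩ := Finite.exists_equiv_fin H
  have : ∀ᶠ s : ℝ in cofinite, ∀ q : H × H × P × P, q.1 ≠ q.2.1 → v q.2.2.1 ≠ 0 →
      (v q.2.2.1 * (((e q.1 : ℕ) : ℝ) - ((e q.2.1 : ℕ) : ℝ))) * s +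
        (β q.1 q.2.2.1 - β q.2.1 q.2.2.2) ≠ 0 := by
    rw [eventually_all]
    rintro ⟨h, h', p, p'⟩
    by_cases hh : h ≠ h' ∧ v p ≠ 0
    · have h1 : v p * (((e h : ℕ) : ℝ) - ((e h' : ℕ) : ℝ)) ≠ 0 :=
        mul_ne_zero hh.2 (sub_ne_zero.2 fun h0 => hh.1
          (e.injective (Fin.ext (by exact_mod_cast h0))))
      exact (eventually_cofinite_linear_ne (b := β h p - β h' p') (Or.inl h1)).mono
        fun s hs _ _ => hs
    · exact Eventually.of_forall fun s h1 h2 => absurd ⟨h1, h2⟩ hh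
  obtain ⟨s, hs⟩ := this.exists
  refine ⟨fun h => s * ((e h : ℕ) : ℝ), fun h h' hh p p' hv hp heq => hs (h, h', p, p') hh hp ?_⟩
  simp only
  rw [← hv] at heq
  linarith

/-- A finite sparse system of homothetic copies of `X` unavoidable for `k`-colourings. -/
def SparseGallai (m : ℕ) : Prop :=
  ∀ (X : Finset ℝ) (k : ℕ), ∃ (J : Type) (_ : Fintype J) (b l : J → ℝ), (∀ j, l j ≠ 0) ∧
    SparseFamily m (fun j => (fun x => b j + l j * x) '' (X : Set ℝ)) ∧
    ∀ c : ℝ → Fin k, ∃ j κ, ∀ x ∈ X, c (b j + l j * x) = κ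

/-- The partite system over a system `(b₀, l₀)` of copies of `X`, after treating the values `W`. -/
theorem exists_partite_system {m : ℕ} (ih : SparseGallai m) (X : Finset ℝ) (k : ℕ)
    {J₀ : Type} [Fintype J₀] (b₀ l₀ : J₀ → ℝ) (hl₀ : ∀ j, l₀ j ≠ 0) (W : Finset ℝ) :
    ∃ (J : Type) (_ : Fintype J) (π : J → J₀) (b u : J → ℝ),
      SparseFamily (m + 1)
        (fun j => (fun x => (b₀ (π j) + l₀ (π j) * x, b j + u j * x)) '' (X : Set ℝ)) ∧
      ∀ c : ℝ × ℝ → Fin k, ∃ φ : ℝ → Fin k, ∀ j₀, ∃ j, π j = j₀ ∧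
        ∀ x ∈ X, b₀ j₀ + l₀ j₀ * x ∈ W → c (b₀ j₀ + l₀ j₀ * x, b j + u j * x) =
          φ (b₀ j₀ + l₀ j₀ * x) := by
  classical
  induction W using Finset.induction_on with
  | empty =>
    obtain ⟨n, ⟨e⟩⟩ := Finite.exists_equiv_fin J₀
    -- The copies start on distinct horizontal levels, hence pairwise disjoint.
    refine ⟨J₀, inferInstance, id, fun j => ((e j : ℕ) : ℝ), fun _ => 0, ?_, ?_⟩
    · intro F hF _
      refine TwoEars.of_forall hF fun j _ => IsEar.of_subsingleton ∅ Set.subsingleton_empty ?_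
      rintro _ ⟨x, _, rfl⟩ f _ hfe ⟨x', _, h⟩
      refine hfe (e.injective (Fin.ext ?_))
      simp only [Prod.mk.injEq, zero_mul, add_zero] at h
      exact_mod_cast h.2
    · intro c
      exact ⟨fun _ => c (0, 0), fun j₀ => ⟨j₀, rfl, fun x _ h => by simp at h⟩⟩
  | insert w W _ ihW =>
    obtain ⟨J, _, π, b, u, hsp, hcol⟩ := ihW
    let pt : J → ℝ → ℝ × ℝ := fun j x => (b₀ (π j) + l₀ (π j) * x, b j + u j * x)
    -- The heights of the points of the current picture over `w`. Copies of the picture will be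
    -- glued along copies of `Y`.
    let Y : Finset ℝ :=
      (((Finset.univ : Finset J) ×ˢ X).filter (fun q => (pt q.1 q.2).1 = w)).image
        (fun q => (pt q.1 q.2).2)
    have hY : ∀ j, ∀ x ∈ X, (pt j x).1 = w → (pt j x).2 ∈ Y := fun j x hx hw =>
      Finset.mem_image.2 ⟨(j, x), Finset.mem_filter.2
        ⟨Finset.mem_product.2 ⟨Finset.mem_univ _, hx⟩, hw⟩, rfl⟩
    obtain ⟨H, _, β, μ, hμ, hHsp, hHcol⟩ := ih Y k
    obtain ⟨t, ht⟩ := exists_generic_shift (H := H) (P := J × X)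
      (fun h q => β h + μ h * (pt q.1 q.2).2) (fun q => (pt q.1 q.2).1 - w)
    -- The shear term vanishes over `w`, where `A h` is the homothety supplied for `Y`; elsewhere
    -- the generic `t` keeps different copies of the picture disjoint.
    let A : H → ℝ × ℝ → ℝ × ℝ := fun h q => (q.1, β h + μ h * q.2 + (q.1 - w) * t h)
    have hA : ∀ h, Function.Injective (A h) := by
      rintro h ⟨v, p⟩ ⟨v', p'⟩ hq
      simp only [A, Prod.mk.injEq] at hq
      obtain ⟨rfl, hq⟩ := hq
      refine Prod.ext rfl (mul_left_cancel₀ (hμ h) ?_)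
      simpa using hq
    let B : H × J → ℝ := fun q => β q.1 + μ q.1 * b q.2 + (b₀ (π q.2) - w) * t q.1
    let U : H × J → ℝ := fun q => μ q.1 * u q.2 + l₀ (π q.2) * t q.1
    have hApt : ∀ q : H × J, ∀ x,
        (b₀ (π q.2) + l₀ (π q.2) * x, B q + U q * x) = A q.1 (pt q.2 x) := by
      intro q x
      refine Prod.ext rfl ?_
      simp only [A, B, U, pt]
      ring
    refine ⟨H × J, inferInstance, fun q => π q.2, B, U, ?_, ?_⟩
    · intro F hF hFm
      simp only [hApt]
      have hmeet : ∀ q ∈ F, ∀ q' ∈ F, q.1 ≠ q'.1 →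
          ∀ x ∈ X, ∀ x' ∈ X, A q.1 (pt q.2 x) = A q'.1 (pt q'.2 x') → (pt q.2 x).1 = w := by
        intro q _ q' _ hne x hx x' hx' heq
        by_contra hw
        have h1 : (pt q.2 x).1 = (pt q'.2 x').1 := (Prod.mk.inj heq).1
        exact ht q.1 q'.1 hne (q.2, ⟨x, hx⟩) (q'.2, ⟨x', hx'⟩) (by simp only [h1])
          (sub_ne_zero.2 hw) (congrArg Prod.snd heq)
      -- If all members lie in different copies of the picture, each meets the others only at its
      -- single point over `w`. Otherwise fewer than `m` copies are involved, so the hypothesis for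
      -- `m` applies to them.
      by_cases hinj : (F.image Prod.fst).card = F.card
      · refine TwoEars.of_forall hF fun q hq => IsEar.of_subsingleton
          {p | ∃ x ∈ X, p = A q.1 (pt q.2 x) ∧ (pt q.2 x).1 = w} ?_ ?_
        · rintro _ ⟨x, _, rfl, hx⟩ _ ⟨x', _, rfl, hx'⟩
          have : x = x' := mul_left_cancel₀ (hl₀ (π q.2)) (by simp only [pt] at hx hx'; linarith)
          rw [this]
        · rintro _ ⟨x, hx, rfl⟩ q' hq' hne ⟨x', hx', heq⟩
          refine ⟨x, hx, rfl, hmeet q hq q' hq' (fun h => hne ?_) x hx x' hx' heq.symm⟩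
          exact (Finset.card_image_iff.1 hinj hq hq' h).symm
      · have hlt : (F.image Prod.fst).card < F.card := lt_of_le_of_ne Finset.card_image_le hinj
        refine TwoEars.amalgam Prod.fst
          (fun h => (fun p => (w, p)) '' ((fun x => β h + μ h * x) '' (Y : Set ℝ))) hF ?_ ?_ ?_
        · rintro q hq q' hq' hne _ ⟨x, hx, rfl⟩ ⟨x', hx', heq⟩
          have hw := hmeet q hq q' hq' hne x hx x' hx' heq.symm
          refine ⟨_, ⟨_, hY _ x hx hw, rfl⟩, ?_⟩
          exact Prod.ext hw.symm (by simp [A, hw])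
        · intro h F' hF' hh hc
          have hF'c : F'.card ≤ F.card := Finset.card_le_card hF'
          have hinj' : Set.InjOn Prod.snd (F' : Set (H × J)) := fun q hq q' hq' hqq =>
            Prod.ext ((hh q hq).trans (hh q' hq').symm) hqq
          have hcard : (F'.image Prod.snd).card = F'.card := Finset.card_image_of_injOn hinj'
          have := hsp (F'.image Prod.snd) (by omega) (by omega)
          have h2 := TwoEars.image (s' := fun q : H × J => (fun x => A q.1 (pt q.2 x)) '' (X : Set ℝ))
            (fun j => (h, j)) (fun _ _ _ _ hj => (Prod.mk.inj hj).2) (A h)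
            (fun _ _ _ _ _ _ _ _ hpq => hA h hpq) (fun j _ => by
              simp only [Set.image_image, pt]) this
          rwa [Finset.image_image, Finset.image_congr (g := id), Finset.image_id] at h2
          intro q hq
          exact Prod.ext (hh q hq).symm rfl
        · intro hc
          exact (hHsp _ hc (by omega)).map_points (fun p => (w, p))
            (fun _ _ _ _ _ _ _ _ hpq => (Prod.mk.inj hpq).2) (fun _ _ => rfl)
    · intro c
      -- First a copy of `Y` over `w` that is monochromatic, then the old picture with the colouring
      -- pulled back to the copy attached there.
      obtain ⟨h, κ, hκ⟩ := hHcol (fun p => c (w, p))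
      obtain ⟨φ, hφ⟩ := hcol (fun q => c (A h q))
      refine ⟨Function.update φ w κ, fun j₀ => ?_⟩
      obtain ⟨j, rfl, hj⟩ := hφ j₀
      refine ⟨(h, j), rfl, fun x hx hmem => ?_⟩
      have hAx := hApt (h, j) x
      simp only at hAx
      rw [hAx]
      by_cases hw : b₀ (π j) + l₀ (π j) * x = w
      · have h1 : A h (pt j x) = (w, β h + μ h * (pt j x).2) :=
          Prod.ext hw (by simp [A, pt, hw])
        rw [h1, hκ _ (hY j x hx hw), hw, Function.update_self]
      · rw [Function.update_of_ne hw]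
        exact hj x hx ((Finset.mem_insert.1 hmem).resolve_left hw)

/-- When `W` contains every point of a Gallai system, each of its members has a copy in the partite
system whose colours depend only on the first coordinate, and Gallai's property for that induced
colouring gives a monochromatic copy. A generic projection (v, p) ↦ v + τ p returns to the line
without creating coincidences. -/
theorem SparseGallai.succ {m : ℕ} (ih : SparseGallai m) : SparseGallai (m + 1) := by
  classical
  intro X k
  obtain ⟨J₀, _, b₀, l₀, hl₀, hcol₀⟩ := exists_finite_gallai X k
  obtain ⟨J, _, π, b, u, hsp, hcol⟩ := exists_partite_system ih X k b₀ l₀ hl₀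
    ((Finset.univ ×ˢ X).image (fun q : J₀ × ℝ => b₀ q.1 + l₀ q.1 * q.2))
  let pt : J → ℝ → ℝ × ℝ := fun j x => (b₀ (π j) + l₀ (π j) * x, b j + u j * x)
  have h1 : ∀ᶠ τ : ℝ in cofinite, ∀ j, u j * τ + l₀ (π j) ≠ 0 :=
    eventually_all.2 fun j => eventually_cofinite_linear_ne (Or.inr (hl₀ _))
  have h2 : ∀ᶠ τ : ℝ in cofinite, ∀ q : (J × X) × (J × X),
      (pt q.1.1 q.1.2).1 + τ * (pt q.1.1 q.1.2).2 = (pt q.2.1 q.2.2).1 + τ * (pt q.2.1 q.2.2).2 →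
      pt q.1.1 q.1.2 = pt q.2.1 q.2.2 := by
    refine eventually_all.2 fun q => ?_
    by_cases hq : pt q.1.1 q.1.2 = pt q.2.1 q.2.2
    · exact Eventually.of_forall fun _ _ => hq
    · have : (pt q.1.1 q.1.2).2 - (pt q.2.1 q.2.2).2 ≠ 0 ∨
          (pt q.1.1 q.1.2).1 - (pt q.2.1 q.2.2).1 ≠ 0 := by
        by_contra! h
        exact hq (Prod.ext (sub_eq_zero.1 h.2) (sub_eq_zero.1 h.1))
      filter_upwards [eventually_cofinite_linear_ne this] with τ hτ h
      exact absurd (by linarith) hτ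
  obtain ⟨τ, hτ1, hτ2⟩ := (h1.and h2).exists
  have hpt : ∀ j x, (b₀ (π j) + τ * b j) + (u j * τ + l₀ (π j)) * x =
      (pt j x).1 + τ * (pt j x).2 := fun j x => by simp only [pt]; ring
  refine ⟨J, inferInstance, fun j => b₀ (π j) + τ * b j, fun j => u j * τ + l₀ (π j), hτ1, ?_, ?_⟩
  · intro F hF hFm
    refine (hsp F hF hFm).map_points (fun q => q.1 + τ * q.2) ?_ ?_
    · rintro j _ j' _ _ ⟨x, hx, rfl⟩ _ ⟨x', hx', rfl⟩ h
      exact hτ2 ((j, ⟨x, hx⟩), (j', ⟨x', hx'⟩)) h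
    · intro j _
      simp only [Set.image_image, hpt, pt]
  · intro c
    obtain ⟨φ, hφ⟩ := hcol (fun q => c (q.1 + τ * q.2))
    obtain ⟨j₀, κ, hκ⟩ := hcol₀ φ
    obtain ⟨j, rfl, hj⟩ := hφ j₀
    refine ⟨j, κ, fun x hx => ?_⟩
    rw [hpt, ← hκ x hx]
    exact hj x hx (Finset.mem_image.2 ⟨(π j, x), by simp [hx], rfl⟩)

theorem sparseGallai (m : ℕ) : SparseGallai m := by
  induction m with
  | zero =>
    intro X k
    obtain ⟨J, _, b, l, hl, h⟩ := exists_finite_gallai X k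
    exact ⟨J, inferInstance, b, l, hl, fun F _ h => absurd h (Nat.not_lt_zero _), h⟩
  | succ m ih => exact ih.succ

/-! ### Angles between circles in coordinates -/

theorem Plane.inner_eq (u v : Plane) : inner ℝ u v = u 0 * v 0 + u 1 * v 1 := by
  simp [PiLp.inner_apply, Fin.sum_univ_two, mul_comm]

theorem Plane.norm_sq_eq (u : Plane) : ‖u‖ ^ 2 = u 0 ^ 2 + u 1 ^ 2 := by
  rw [EuclideanSpace.norm_sq_eq]; simp [Fin.sum_univ_two]

theorem Plane.exists_smul_perp {u w : Plane} (hw : w ≠ 0) (h : inner ℝ w u = 0) :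
    ∃ a : ℝ, u = a • (!₂[-w 1, w 0] : Plane) := by
  have hw' : w 0 ^ 2 + w 1 ^ 2 ≠ 0 := by
    rw [← Plane.norm_sq_eq]; simpa using hw
  rw [Plane.inner_eq] at h
  refine ⟨(w 0 * u 1 - w 1 * u 0) / (w 0 ^ 2 + w 1 ^ 2), ?_⟩
  ext i
  fin_cases i
  · simp
    field_simp
    linear_combination (w 0) * h
  · simp
    field_simp
    linear_combination (w 1) * h

theorem Plane.cos_angle_perp_smul (w₁ w₂ : Plane) {a b : ℝ} (ha : a ≠ 0) (hb : b ≠ 0) :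
    |inner ℝ (a • (!₂[-w₁ 1, w₁ 0] : Plane)) (b • (!₂[-w₂ 1, w₂ 0] : Plane)) /
      (‖a • (!₂[-w₁ 1, w₁ 0] : Plane)‖ * ‖b • (!₂[-w₂ 1, w₂ 0] : Plane)‖)| =
      |inner ℝ w₁ w₂| / (‖w₁‖ * ‖w₂‖) := by
  have hn : ∀ w : Plane, ‖(!₂[-w 1, w 0] : Plane)‖ = ‖w‖ := by
    intro w
    rw [← sq_eq_sq₀ (norm_nonneg _) (norm_nonneg _), Plane.norm_sq_eq, Plane.norm_sq_eq]
    simp [add_comm]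
  have hi : inner ℝ (!₂[-w₁ 1, w₁ 0] : Plane) (!₂[-w₂ 1, w₂ 0] : Plane) = inner ℝ w₁ w₂ := by
    rw [Plane.inner_eq, Plane.inner_eq]
    simp [add_comm]
  rw [real_inner_smul_left, real_inner_smul_right, norm_smul, norm_smul, hn, hn, hi, abs_div]
  simp only [abs_mul, abs_norm, Real.norm_eq_abs, abs_abs]
  have := abs_pos.2 ha
  have := abs_pos.2 hb
  rw [show |a| * (|b| * |inner ℝ w₁ w₂|) = (|a| * |b|) * |inner ℝ w₁ w₂| by ring,
    show |a| * ‖w₁‖ * (|b| * ‖w₂‖) = (|a| * |b|) * (‖w₁‖ * ‖w₂‖) by ring,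
    mul_div_mul_left _ _ (by positivity)]

/-- Tangent directions are the radius vectors turned by a right angle, so tangents make the same
angles as radii; the absolute value selects the smaller one. -/
theorem lineAngle_orthRadius {C₁ C₂ : Sphere Plane} {p : Plane} (h₁ : p ≠ C₁.center)
    (h₂ : p ≠ C₂.center) :
    lineAngle (C₁.orthRadius p) (C₂.orthRadius p) =
      Real.arccos (|inner ℝ (p - C₁.center) (p - C₂.center)| /
        (‖p - C₁.center‖ * ‖p - C₂.center‖)) := by
  have hw₁ : p - C₁.center ≠ 0 := sub_ne_zero.2 h₁
  have hw₂ : p - C₂.center ≠ 0 := sub_ne_zero.2 h₂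
  have hdir : ∀ C : Sphere Plane, ∀ u, u ∈ (C.orthRadius p).direction ↔
      inner ℝ (p - C.center) u = 0 := by
    intro C u
    rw [Sphere.direction_orthRadius, Submodule.mem_orthogonal_singleton_iff_inner_right,
      vsub_eq_sub]
  unfold lineAngle
  apply IsLeast.csInf_eq
  constructor
  · have hJ : ∀ w : Plane, w ≠ 0 → (!₂[-w 1, w 0] : Plane) ≠ 0 := by
      intro w hw h0
      apply hw
      have e0 := congrArg (fun v : Plane => v 0) h0
      have e1 := congrArg (fun v : Plane => v 1) h0
      ext i
      fin_cases i
      · simpa using e1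
      · simpa using e0
    have hJm : ∀ C : Sphere Plane, ∀ a : ℝ, a • (!₂[-(p - C.center) 1, (p - C.center) 0] : Plane) ∈
        (C.orthRadius p).direction := by
      intro C a
      rw [hdir, Plane.inner_eq]
      simp
      ring
    set w₁ := p - C₁.center
    set w₂ := p - C₂.center
    have key : ∀ b : ℝ, b ≠ 0 →
        0 ≤ inner ℝ ((1 : ℝ) • (!₂[-w₁ 1, w₁ 0] : Plane)) (b • (!₂[-w₂ 1, w₂ 0] : Plane)) →
        Real.arccos (|inner ℝ w₁ w₂| / (‖w₁‖ * ‖w₂‖)) = InnerProductGeometry.angle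
          ((1 : ℝ) • (!₂[-w₁ 1, w₁ 0] : Plane)) (b • (!₂[-w₂ 1, w₂ 0] : Plane)) := by
      intro b hb hpos
      rw [InnerProductGeometry.angle, ← Plane.cos_angle_perp_smul w₁ w₂ one_ne_zero hb,
        abs_of_nonneg (div_nonneg hpos (by positivity))]
    rcases le_total 0 (inner ℝ ((1 : ℝ) • (!₂[-w₁ 1, w₁ 0] : Plane))
      ((1 : ℝ) • (!₂[-w₂ 1, w₂ 0] : Plane))) with h | h
    · exact ⟨_, hJm C₁ 1, _, hJm C₂ 1, smul_ne_zero one_ne_zero (hJ _ hw₁),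
        smul_ne_zero one_ne_zero (hJ _ hw₂), key 1 one_ne_zero h⟩
    · refine ⟨_, hJm C₁ 1, _, hJm C₂ (-1), smul_ne_zero one_ne_zero (hJ _ hw₁),
        smul_ne_zero (by norm_num) (hJ _ hw₂), key (-1) (by norm_num) ?_⟩
      rw [neg_smul, inner_neg_right]
      linarith
  · rintro _ ⟨u, hu, v, hv, hu0, hv0, rfl⟩
    rw [hdir] at hu hv
    obtain ⟨a, rfl⟩ := Plane.exists_smul_perp hw₁ hu
    obtain ⟨b, rfl⟩ := Plane.exists_smul_perp hw₂ hv
    have ha : a ≠ 0 := by rintro rfl; simp at hu0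
    have hb : b ≠ 0 := by rintro rfl; simp at hv0
    rw [InnerProductGeometry.angle, ← Plane.cos_angle_perp_smul _ _ ha hb]
    exact Real.antitone_arccos (le_abs_self _)

/-- The algebraic form of the relation of intersecting at the angle `arccos c`, for circles with
centres `(x, y)`, `(x', y')` and radii `r`, `r'`. -/
def AngleRel (c x y r x' y' r' : ℝ) : Prop :=
  ((x - x') ^ 2 + (y - y') ^ 2 - r ^ 2 - r' ^ 2) ^ 2 = 4 * c ^ 2 * r ^ 2 * r' ^ 2

theorem exists_mem_inter {x y r x' y' r' c : ℝ} (hc : 0 ≤ c) (hc1 : c < 1) (hr : 0 < r)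
    (hr' : 0 < r') (h : AngleRel c x y r x' y' r') :
    ∃ p q : ℝ, (p - x) ^ 2 + (q - y) ^ 2 = r ^ 2 ∧ (p - x') ^ 2 + (q - y') ^ 2 = r' ^ 2 := by
  unfold AngleRel at h
  set D := (x - x') ^ 2 + (y - y') ^ 2 with hD
  have hc2 : c ^ 2 < 1 := by nlinarith
  have hrr : 0 < r ^ 2 * r' ^ 2 := by positivity
  have hD0 : 0 < D := by
    rcases (show 0 ≤ D by positivity).lt_or_eq with h0 | h0
    · exact h0
    · rw [← h0] at h
      nlinarith [sq_nonneg (r ^ 2 - r' ^ 2)]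
  -- By the relation, this discriminant equals 4 (1 - c²) r² r'².
  have hdisc : 0 ≤ 4 * r ^ 2 * D - (D + r ^ 2 - r' ^ 2) ^ 2 := by nlinarith
  set α := (D + r ^ 2 - r' ^ 2) / (2 * D) with hα
  set β := Real.sqrt (4 * r ^ 2 * D - (D + r ^ 2 - r' ^ 2) ^ 2) / (2 * D) with hβ
  have hαe : α * (2 * D) = D + r ^ 2 - r' ^ 2 := div_mul_cancel₀ _ (by positivity)
  have hβe : (β * (2 * D)) ^ 2 = 4 * r ^ 2 * D - (D + r ^ 2 - r' ^ 2) ^ 2 := by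
    rw [hβ, div_mul_cancel₀ _ (by positivity), Real.sq_sqrt hdisc]
  have hsum : (α ^ 2 + β ^ 2) * D = r ^ 2 := by
    have h4 : 4 * D ≠ 0 := by positivity
    apply mul_left_cancel₀ h4
    rw [← hαe] at hβe
    linear_combination hβe
  refine ⟨x + α * (x' - x) - β * (y' - y), y + α * (y' - y) + β * (x' - x), ?_, ?_⟩
  · rw [← hsum, hD]; ring
  · have : r' ^ 2 = r ^ 2 + D - α * (2 * D) := by linarith
    rw [this, ← hsum, hD]; ring

/-- By the law of cosines, the inner product of the two radius vectors is the same at every common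
point; squaring absorbs the choice of the smaller angle. A common point exists by
`exists_mem_inter`. -/
theorem intersectAtAngle_iff {θ : ℝ} (hθ : θ ∈ Set.Ioc 0 (Real.pi / 2)) {C₁ C₂ : Sphere Plane}
    (h₁ : 0 < C₁.radius) (h₂ : 0 < C₂.radius) :
    IntersectAtAngle θ C₁ C₂ ↔ AngleRel (Real.cos θ) (C₁.center 0) (C₁.center 1) C₁.radius
      (C₂.center 0) (C₂.center 1) C₂.radius := by
  have hc : 0 ≤ Real.cos θ := Real.cos_nonneg_of_mem_Icc ⟨by linarith [hθ.1, Real.pi_pos], hθ.2⟩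
  have hc1 : Real.cos θ < 1 := by
    rw [← Real.cos_zero]
    exact Real.cos_lt_cos_of_nonneg_of_le_pi_div_two le_rfl hθ.2 hθ.1
  have hmem : ∀ C : Sphere Plane, 0 < C.radius → ∀ p : Plane,
      p ∈ C ↔ (p 0 - C.center 0) ^ 2 + (p 1 - C.center 1) ^ 2 = C.radius ^ 2 := by
    intro C hC p
    rw [mem_sphere, dist_eq_norm, ← sq_eq_sq₀ (norm_nonneg _) hC.le, Plane.norm_sq_eq]
    simp
  have key : ∀ p : Plane, p ∈ C₁ → p ∈ C₂ →
      (lineAngle (C₁.orthRadius p) (C₂.orthRadius p) = θ ↔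
        AngleRel (Real.cos θ) (C₁.center 0) (C₁.center 1) C₁.radius
      (C₂.center 0) (C₂.center 1) C₂.radius) := by
    intro p hp₁ hp₂
    have n₁ : ‖p - C₁.center‖ = C₁.radius := by rw [← dist_eq_norm]; exact hp₁
    have n₂ : ‖p - C₂.center‖ = C₂.radius := by rw [← dist_eq_norm]; exact hp₂
    have hne₁ : p ≠ C₁.center := fun h => by rw [h, sub_self, norm_zero] at n₁; linarith
    have hne₂ : p ≠ C₂.center := fun h => by rw [h, sub_self, norm_zero] at n₂; linarith
    have hle := abs_real_inner_le_norm (p - C₁.center) (p - C₂.center)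
    rw [lineAngle_orthRadius hne₁ hne₂]
    rw [n₁, n₂] at *
    rw [hmem C₁ h₁] at hp₁
    rw [hmem C₂ h₂] at hp₂
    have hin : (C₁.center 0 - C₂.center 0) ^ 2 + (C₁.center 1 - C₂.center 1) ^ 2 -
        C₁.radius ^ 2 - C₂.radius ^ 2 = -2 * inner ℝ (p - C₁.center) (p - C₂.center) := by
      rw [Plane.inner_eq, ← hp₁, ← hp₂]
      simp only [PiLp.sub_apply]
      ring
    have hrr : 0 < C₁.radius * C₂.radius := mul_pos h₁ h₂
    have e1 : Real.arccos (|inner ℝ (p - C₁.center) (p - C₂.center)| /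
        (C₁.radius * C₂.radius)) = θ ↔
        |inner ℝ (p - C₁.center) (p - C₂.center)| / (C₁.radius * C₂.radius) = Real.cos θ := by
      constructor
      · intro h
        rw [← h, Real.cos_arccos]
        · linarith [show 0 ≤ |inner ℝ (p - C₁.center) (p - C₂.center)| /
            (C₁.radius * C₂.radius) by positivity]
        · exact (div_le_one hrr).2 hle
      · intro h
        rw [h, Real.arccos_cos hθ.1.le (by linarith [hθ.2, Real.pi_pos])]
    rw [e1, div_eq_iff hrr.ne', ← sq_eq_sq₀ (abs_nonneg _) (by positivity), sq_abs, AngleRel, hin]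
    constructor
    · intro h; linear_combination 4 * h
    · intro h; linear_combination h / 4
  constructor
  · rintro ⟨⟨p, hp₁, hp₂⟩, h⟩
    exact (key p hp₁ hp₂).1 (h p hp₁ hp₂)
  · intro h
    obtain ⟨p, q, hp, hq⟩ := exists_mem_inter hc hc1 h₁ h₂ h
    exact ⟨⟨!₂[p, q], (hmem C₁ h₁ _).2 (by simpa using hp), (hmem C₂ h₂ _).2 (by simpa using hq)⟩,
      fun p hp₁ hp₂ => (key p hp₁ hp₂).2 h⟩

/-! ### Inversion at a generic centre -/

theorem eventually_cofinite_sextic_ne {c₆ c₄ c₃ c₂ c₁ c₀ : ℝ}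
    (h : c₆ ≠ 0 ∨ c₄ ≠ 0 ∨ c₃ ≠ 0 ∨ c₂ ≠ 0 ∨ c₁ ≠ 0 ∨ c₀ ≠ 0) :
    ∀ᶠ t in cofinite, c₆ * t ^ 6 + c₄ * t ^ 4 + c₃ * t ^ 3 + c₂ * t ^ 2 + c₁ * t + c₀ ≠ 0 := by
  open Polynomial in
  let P : ℝ[X] := C c₆ * X ^ 6 + C c₄ * X ^ 4 + C c₃ * X ^ 3 + C c₂ * X ^ 2 + C c₁ * X + C c₀
  have hP : P ≠ 0 := by
    intro h0
    have hc : ∀ n, P.coeff n = 0 := fun n => by rw [h0, Polynomial.coeff_zero]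
    have h6 := hc 6
    have h4 := hc 4
    have h3 := hc 3
    have h2 := hc 2
    have h1 := hc 1
    have h0 := hc 0
    simp [P, Polynomial.coeff_X, Polynomial.coeff_C] at h6 h4 h3 h2 h1 h0
    simp_all
  have := Polynomial.finite_setOfPred_isRoot hP
  refine (Filter.eventually_cofinite).2 (this.subset fun t ht => ?_)
  simpa [P, Polynomial.IsRoot] using ht

/-- The inversion at a generic centre of a finite system of circles and vertical lines, given by
the coefficients of equations `a (X² + Y²) - 2 p X - 2 q Y + d = 0`, consists of circles. -/
theorem exists_generic_inversion {V : Type*} [Finite V] {S : Finset ℝ} (hneg : ∀ s ∈ S, -s ∈ S)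
    (hS : ∀ s ∈ S, -1 < s) {a p q d ρ : V → ℝ} (hρ : ∀ v, 0 < ρ v)
    (hQ : ∀ v, p v ^ 2 + q v ^ 2 - a v * d v = ρ v ^ 2)
    (hV : ∀ v, a v = 1 ∨ a v = 0 ∧ p v = 1 ∧ q v = 0 ∧ ρ v = 1)
    (hcirc : ∀ v w, v ≠ w → a v = 1 → a w = 1 → p v ≠ p w ∨ q v ≠ q w)
    (hline : ∀ v w, v ≠ w → a v = 0 → a w = 0 → d v ≠ d w) :
    ∃ x y r : V → ℝ, (∀ v, 0 < r v) ∧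
      (∀ v w, v ≠ w → ∀ s ∈ S, ∀ t ∈ S, x v + s * r v ≠ x w + t * r w) ∧
      ∀ c v w, AngleRel c (x v) (y v) (r v) (x w) (y w) (r w) ↔
        (2 * (p v * p w + q v * q w) - a v * d w - a w * d v) ^ 2 =
          4 * c ^ 2 * ρ v ^ 2 * ρ w ^ 2 := by
  -- The equation evaluated at the inversion centre (t, t³). On this cubic the `p` and `q` terms
  -- have different degrees, so one parameter is enough for genericity.
  let A : V → ℝ → ℝ := fun v t => a v * (t ^ 2 + t ^ 6) - 2 * p v * t - 2 * q v * t ^ 3 + d v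
  have h1 : ∀ᶠ t in cofinite, ∀ v, A v t ≠ 0 := by
    refine eventually_all.2 fun v => ?_
    have : a v ≠ 0 ∨ (0 : ℝ) ≠ 0 ∨ -2 * q v ≠ 0 ∨ a v ≠ 0 ∨ -2 * p v ≠ 0 ∨ d v ≠ 0 := by
      rcases hV v with h | h
      · left; rw [h]; exact one_ne_zero
      · right; right; right; right; left; rw [h.2.1]; norm_num
    filter_upwards [eventually_cofinite_sextic_ne this] with t ht h0
    exact ht (by simp only [A] at h0; linear_combination h0)
  have h2 : ∀ᶠ z in cofinite, ∀ v w, v ≠ w → ∀ s ∈ S, ∀ t ∈ S,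
      (p v - a v * z + s * ρ v) * A w z ≠ (p w - a w * z + t * ρ w) * A v z := by
    refine eventually_all.2 fun v => eventually_all.2 fun w => ?_
    by_cases hvw : v = w
    · exact Eventually.of_forall fun _ h => absurd hvw h
    suffices ∀ s ∈ S, ∀ t ∈ S, ∀ᶠ z in cofinite,
        (p v - a v * z + s * ρ v) * A w z ≠ (p w - a w * z + t * ρ w) * A v z by
      have := (Filter.eventually_all_finset S).2 fun s hs =>
        (Filter.eventually_all_finset S).2 (this s hs)
      exact this.mono fun z hz _ => hz
    intro s hs t ht
    let B := p v + s * ρ v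
    let B' := p w + t * ρ w
    -- Coefficients in degrees 6, 4, 3, 2, 1, 0 of the difference of the two sides; degree 7
    -- cancels. If all vanished, degrees 6, 4, 2 would give two circles the same centre, degree 6
    -- would give 1 + s = 0 or 1 + t = 0 for a circle and a line, and degrees 1, 0 would make two
    -- lines coincide.
    have : B * a w - B' * a v ≠ 0 ∨ 2 * a v * q w - 2 * a w * q v ≠ 0 ∨
        -2 * B * q w + 2 * B' * q v ≠ 0 ∨
        B * a w - B' * a v + 2 * a v * p w - 2 * a w * p v ≠ 0 ∨
        -2 * B * p w + 2 * B' * p v - a v * d w + a w * d v ≠ 0 ∨ B * d w - B' * d v ≠ 0 := by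
      have hs1 := hS s hs
      have ht1 := hS t ht
      by_contra! h
      obtain ⟨e6, e4, e3, e2, e1, e0⟩ := h
      rcases hV v with hv | ⟨hv, hpv, _, hρv⟩ <;> rcases hV w with hw | ⟨hw, hpw, _, hρw⟩
      · rw [hv, hw] at e6 e4 e2
        rcases hcirc v w hvw hv hw with h | h
        · exact h (by linarith)
        · exact h (by linarith)
      · simp only [B, B', hv, hw, hpw, hρw] at e6
        linarith
      · simp only [B, B', hv, hw, hpv, hρv] at e6
        linarith
      · simp only [B, B', hv, hw, hpv, hρv, hpw, hρw] at e1 e0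
        have hst : s = t := by linarith
        subst hst
        refine hline v w hvw hv hw (mul_left_cancel₀ (show 1 + s ≠ 0 by linarith) ?_)
        linarith
    filter_upwards [eventually_cofinite_sextic_ne this] with z hz h0
    exact hz (by simp only [A, B, B'] at h0 ⊢; linear_combination h0)
  obtain ⟨z, hz1, hz2⟩ := (h1.and h2).exists
  refine ⟨fun v => (p v - a v * z) / A v z, fun v => (q v - a v * z ^ 3) / A v z,
    fun v => ρ v / |A v z|, fun v => div_pos (hρ v) (abs_pos.2 (hz1 v)), ?_, ?_⟩
  · intro v w hvw s hs t ht
    -- A negative `A v z` replaces s by -s, hence the symmetry required of `S`.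
    have aux : ∀ v, ∀ s ∈ S, ∃ s' ∈ S, (p v - a v * z) / A v z + s * (ρ v / |A v z|) =
        (p v - a v * z + s' * ρ v) / A v z := by
      intro v s hs
      rcases abs_choice (A v z) with h | h
      · exact ⟨s, hs, by rw [h]; ring⟩
      · exact ⟨-s, hneg s hs, by rw [h, div_neg]; ring⟩
    obtain ⟨s', hs', e1⟩ := aux v s hs
    obtain ⟨t', ht', e2⟩ := aux w t ht
    rw [e1, e2, Ne, div_eq_div_iff (hz1 v) (hz1 w)]
    exact hz2 v w hvw s' hs' t' ht'
  · intro c v w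
    -- The power of the inversion centre, moved to the origin, with respect to the image circle.
    have hself : ∀ v, ((p v - a v * z) / A v z) ^ 2 + ((q v - a v * z ^ 3) / A v z) ^ 2 -
        (ρ v / |A v z|) ^ 2 = a v / A v z := by
      intro v
      have := hz1 v
      rw [div_pow, div_pow, div_pow, sq_abs, ← hQ v]
      field_simp
      simp only [A]
      ring
    have hv := hz1 v
    have hw := hz1 w
    have hpair : ((p v - a v * z) / A v z - (p w - a w * z) / A w z) ^ 2 +
        ((q v - a v * z ^ 3) / A v z - (q w - a w * z ^ 3) / A w z) ^ 2 -
        (ρ v / |A v z|) ^ 2 - (ρ w / |A w z|) ^ 2 =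
        -(2 * (p v * p w + q v * q w) - a v * d w - a w * d v) / (A v z * A w z) := by
      have e : -(2 * (p v * p w + q v * q w) - a v * d w - a w * d v) =
          a v * A w z + a w * A v z - 2 * ((p v - a v * z) * (p w - a w * z) +
            (q v - a v * z ^ 3) * (q w - a w * z ^ 3)) := by
        simp only [A]; ring
      have e' : (a v * A w z + a w * A v z - 2 * ((p v - a v * z) * (p w - a w * z) +
            (q v - a v * z ^ 3) * (q w - a w * z ^ 3))) / (A v z * A w z) =
          a v / A v z + a w / A w z - 2 * ((p v - a v * z) / A v z * ((p w - a w * z) / A w z) +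
            (q v - a v * z ^ 3) / A v z * ((q w - a w * z ^ 3) / A w z)) := by
        field_simp
      rw [e, e', ← hself v, ← hself w]
      ring
    rw [AngleRel, hpair, div_pow, div_pow, div_pow, sq_abs, sq_abs, neg_sq, mul_pow,
      div_eq_iff (by positivity)]
    have e : 4 * c ^ 2 * (ρ v ^ 2 / A v z ^ 2) * (ρ w ^ 2 / A w z ^ 2) *
        (A v z ^ 2 * A w z ^ 2) = 4 * c ^ 2 * ρ v ^ 2 * ρ w ^ 2 := by
      field_simp
    rw [e]

/-! ### Girth and amalgams of graphs -/

/-- The edges of `G`, as a hypergraph, have no cycle of length less than `g`. -/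
def SimpleGraph.EdgeSparse {V : Type*} (G : SimpleGraph V) (g : ℕ) : Prop :=
  ∀ F : Finset (Sym2 V), (∀ e ∈ F, e ∈ G.edgeSet) → 2 ≤ F.card → F.card < g →
    TwoEars (fun e : Sym2 V => {v | v ∈ e}) F

/-- Both endpoints of an edge of a cycle lie on other edges of the cycle, so the edges of a cycle
have no ear. -/
theorem SimpleGraph.EdgeSparse.le_egirth {V : Type*} {G : SimpleGraph V} {g : ℕ}
    (h : G.EdgeSparse g) : (g : ℕ∞) ≤ G.egirth := by
  classical
  rw [SimpleGraph.le_egirth]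
  intro a w hw
  by_contra hlt
  have hlt : w.length < g := by
    rw [not_le] at hlt
    exact_mod_cast hlt
  have hcard : w.edges.toFinset.card = w.length := by
    rw [List.toFinset_card_of_nodup hw.edges_nodup, w.length_edges]
  have h3 := hw.three_le_length
  obtain ⟨e, he, -, -, -, hear, -⟩ := h w.edges.toFinset
    (fun e he => w.edges_subset_edgeSet (List.mem_toFinset.1 he)) (by omega) (by omega)
  rw [List.mem_toFinset] at he
  have key : ∀ u v, s(u, v) ∈ w.edges → ∃ f ∈ w.edges.toFinset, f ≠ s(u, v) ∧ u ∈ f := by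
    intro u v huv
    have h2 := hw.ncard_neighborSet_toSubgraph_eq_two (w.fst_mem_support_of_mem_edges huv)
    obtain ⟨v', hv', hne⟩ := Set.exists_ne_of_one_lt_ncard (h2 ▸ one_lt_two) v
    have hadj : w.toSubgraph.Adj u v' := hv'
    rw [← SimpleGraph.Subgraph.mem_edgeSet, SimpleGraph.Walk.mem_edges_toSubgraph] at hadj
    refine ⟨s(u, v'), List.mem_toFinset.2 hadj, fun h => hne ?_, Sym2.mem_mk_left _ _⟩
    exact Sym2.congr_right.1 h
  induction e using Sym2.ind with
  | _ u v =>
    have huv : G.Adj u v := w.edges_subset_edgeSet he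
    refine huv.ne (hear u (Sym2.mem_mk_left _ _) v (Sym2.mem_mk_right _ _) (key u v he) ?_)
    rw [Sym2.eq_swap] at he ⊢
    exact key v u he

/-- Two amalgams are nested. Edges are grouped by the copy `j` that they touch, and different copies
share only vertices of `O`. Within a copy they split into inner edges and, for each `o`, the edge to
`o`, unique by `hatt`. -/
theorem SimpleGraph.EdgeSparse.amalgam {ι J O : Type*} {g : ℕ} {G : SimpleGraph ι}
    {G' : SimpleGraph (O ⊕ (J × ι))} (att : J → O → ι → Prop)
    (hOO : ∀ o o', ¬ G'.Adj (Sum.inl o) (Sum.inl o'))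
    (hcc : ∀ j i j' i', G'.Adj (Sum.inr (j, i)) (Sum.inr (j', i')) → j = j' ∧ G.Adj i i')
    (hOc : ∀ o j i, G'.Adj (Sum.inl o) (Sum.inr (j, i)) → att j o i)
    (hatt : ∀ j o i i', att j o i → att j o i' → i = i')
    (ht : SparseFamily g (fun j => {o | ∃ i, att j o i})) (hG : G.EdgeSparse g) :
    G'.EdgeSparse g := by
  classical
  intro F hF h2 hg
  have hedge : ∀ e ∈ F, ∃ j, (∃ i i', e = s(Sum.inr (j, i), Sum.inr (j, i')) ∧ G.Adj i i') ∨
      ∃ o i, e = s(Sum.inl o, Sum.inr (j, i)) ∧ att j o i := by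
    intro e he
    have he' := hF e he
    induction e using Sym2.ind with
    | _ u v =>
      rw [SimpleGraph.mem_edgeSet] at he'
      rcases u with o | ⟨j, i⟩ <;> rcases v with o' | ⟨j', i'⟩
      · exact absurd he' (hOO o o')
      · exact ⟨j', Or.inr ⟨o, i', rfl, hOc _ _ _ he'⟩⟩
      · exact ⟨j, Or.inr ⟨o', i, Sym2.eq_swap, hOc _ _ _ he'.symm⟩⟩
      · obtain ⟨rfl, hadj⟩ := hcc _ _ _ _ he'
        exact ⟨j, Or.inl ⟨i, i', rfl, hadj⟩⟩
  obtain ⟨e₀, he₀⟩ : F.Nonempty := Finset.card_pos.1 (by omega)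
  have : Nonempty J := ⟨(hedge e₀ he₀).choose⟩
  choose! κ hκ using hedge
  refine TwoEars.amalgam κ (fun j => Sum.inl '' {o | ∃ i, att j o i}) h2 ?_ ?_ ?_
  · have hr : ∀ e ∈ F, ∀ j i, (Sum.inr (j, i) : O ⊕ (J × ι)) ∈ e → j = κ e := by
      intro e he j i hm
      rcases hκ e he with ⟨i₁, i₂, h, -⟩ | ⟨o, i₁, h, -⟩ <;> rw [h] at hm <;> simp at hm <;> tauto
    intro e he f hf hne p hpe hpf
    rcases p with o | ⟨j, i⟩
    · refine ⟨o, ?_, rfl⟩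
      simp only [Set.mem_ofPred_eq] at hpe
      rcases hκ e he with ⟨i₁, i₂, h, -⟩ | ⟨o', i₁, h, h'⟩
      · rw [h] at hpe; simp at hpe
      · rw [h] at hpe
        simp at hpe
        exact ⟨i₁, hpe ▸ h'⟩
    · exact absurd ((hr e he j i hpe).symm.trans (hr f hf j i hpf)) hne
  · intro j F' hF' hj hc
    have hcF : F'.card ≤ F.card := Finset.card_le_card hF'
    have hedge' : ∀ e ∈ F', ∃ w : Option O,
        (w = none ∧ ∃ i i', e = s(Sum.inr (j, i), Sum.inr (j, i')) ∧ G.Adj i i') ∨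
        ∃ o i, w = some o ∧ e = s(Sum.inl o, Sum.inr (j, i)) ∧ att j o i := by
      intro e he
      have := hκ e (hF' he)
      rw [hj e he] at this
      rcases this with h | ⟨o, i, h⟩
      · exact ⟨none, Or.inl ⟨rfl, h⟩⟩
      · exact ⟨some o, Or.inr ⟨o, i, rfl, h⟩⟩
    choose! τ hτ using hedge'
    -- `none` carries all vertices of the copy, `some o` the at most one vertex attached to `o`.
    let t : Option O → Set (O ⊕ (J × ι)) := fun w =>
      w.elim (Set.range Sum.inr) (fun o => {p | ∃ i, p = Sum.inr (j, i) ∧ att j o i})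
    have hsub : ∀ o, (t (some o)).Subsingleton := by
      rintro o _ ⟨i, rfl, hi⟩ _ ⟨i', rfl, hi'⟩
      rw [hatt j o i i' hi hi']
    refine TwoEars.amalgam τ t hc ?_ ?_ ?_
    · intro e he f hf hne p hpe hpf
      simp only [Set.mem_ofPred_eq] at hpe hpf
      rcases hτ e he with ⟨h1, i₁, i₂, h, -⟩ | ⟨o, i, h1, h, hat⟩
      · rw [h1]
        rw [h] at hpe
        simp at hpe
        rcases hpe with rfl | rfl <;> exact ⟨_, rfl⟩
      · rw [h1]
        rw [h] at hpe
        simp at hpe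
        rcases hpe with rfl | rfl
        · exfalso
          rcases hτ f hf with ⟨_, i₁, i₂, h', -⟩ | ⟨o', i, h1', h', -⟩
          · rw [h'] at hpf; simp at hpf
          · rw [h'] at hpf
            simp at hpf
            exact hne (by rw [h1, h1', hpf])
        · exact ⟨i, rfl, hat⟩
    · intro w F'' hF'' hw hc''
      rcases w with _ | o
      · have hcF'' : F''.card ≤ F'.card := Finset.card_le_card hF''
        let φ : Sym2 ι → Sym2 (O ⊕ (J × ι)) := Sym2.map (fun i => Sum.inr (j, i))
        have hφ : Function.Injective φ :=
          Sym2.map.injective fun i i' h => (Prod.mk.inj (Sum.inr.inj h)).2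
        have hran : ∀ e ∈ F'', ∃ e₁ ∈ G.edgeSet, φ e₁ = e := by
          intro e he
          rcases hτ e (hF'' he) with ⟨-, i, i', h, hadj⟩ | ⟨o, i, h1, -⟩
          · exact ⟨s(i, i'), hadj, by rw [h]; rfl⟩
          · rw [hw e he] at h1; cases h1
        have himg : (F''.preimage φ hφ.injOn).image φ = F'' := by
          rw [Finset.image_preimage, Finset.filter_true_of_mem]
          intro e he
          obtain ⟨e₁, -, h⟩ := hran e he
          exact ⟨e₁, h⟩
        have hcard : (F''.preimage φ hφ.injOn).card = F''.card := by
          rw [← Finset.card_image_of_injective _ hφ, himg]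
        rw [← himg]
        refine (hG (F''.preimage φ hφ.injOn) ?_ (by omega) (by omega)).image φ hφ.injOn
          (fun i => Sum.inr (j, i))
          (fun _ _ _ _ _ _ _ _ h => (Prod.mk.inj (Sum.inr.inj h)).2) ?_
        · intro e he
          obtain ⟨e₁, h₁, h⟩ := hran _ (Finset.mem_preimage.1 he)
          rwa [← hφ h]
        · intro e _
          ext p
          simp [φ, Sym2.mem_map]
      · exfalso
        obtain ⟨e, he, f, hf, hne⟩ := Finset.one_lt_card.1 hc''
        apply hne
        rcases hτ e (hF'' he) with ⟨h1, -⟩ | ⟨o₁, i₁, h1, h1', hat1⟩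
        · rw [hw e he] at h1; cases h1
        rcases hτ f (hF'' hf) with ⟨h2, -⟩ | ⟨o₂, i₂, h2, h2', hat2⟩
        · rw [hw f hf] at h2; cases h2
        obtain rfl : o₁ = o₂ := by
          rw [hw e he] at h1
          rw [hw f hf] at h2
          exact Option.some.inj (h1.symm.trans h2)
        rw [h1', h2', hatt j o₁ i₁ i₂ hat1 hat2]
    · intro hcard
      have hear : ∀ F₁ : Finset (Option O), ∀ o, IsEar t F₁ (some o) := fun F₁ o =>
        IsEar.of_subsingleton _ (hsub o) fun p hp _ _ _ _ => hp
      -- Each `some o` is an ear. If only one occurs, `none` meets nothing else and is the second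
      -- ear.
      by_cases hex : ∃ o o', o ≠ o' ∧ some o ∈ F'.image τ ∧ some o' ∈ F'.image τ
      · obtain ⟨o, o', hne, h, h'⟩ := hex
        exact ⟨_, h, _, h', fun h => hne (Option.some.inj h), hear _ _, hear _ _⟩
      · push Not at hex
        refine TwoEars.of_forall hcard fun w hw => ?_
        rcases w with _ | o
        · obtain ⟨w', hw', hne⟩ := Finset.exists_mem_ne hcard (none : Option O)
          obtain ⟨o, rfl⟩ := Option.ne_none_iff_exists'.1 hne
          refine IsEar.of_subsingleton _ (hsub o) fun p _ f hf hfn hpf => ?_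
          obtain ⟨o', rfl⟩ := Option.ne_none_iff_exists'.1 hfn
          by_cases hoo : o = o'
          · rwa [hoo]
          · exact absurd hf (hex o o' hoo hw')
        · exact hear _ _
  · intro hc
    exact (ht _ hc (lt_of_le_of_lt Finset.card_image_le hg)).map_points Sum.inl
      (fun _ _ _ _ _ _ _ _ h => Sum.inl.inj h) (fun _ _ => rfl)

/-! ### Raising the number of colours -/

theorem AngleRel.symm {c x y r x' y' r' : ℝ} (h : AngleRel c x y r x' y' r') :
    AngleRel c x' y' r' x y r := by
  unfold AngleRel at *
  linear_combination h

/-- The graph of a system of circles with the centres `(x i, y i)` and radii `r i`, two circles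
being adjacent when they are related by `AngleRel c`. -/
def angleGraph {ι : Type*} (c : ℝ) (x y r : ι → ℝ) : SimpleGraph ι where
  Adj i j := i ≠ j ∧ AngleRel c (x i) (y i) (r i) (x j) (y j) (r j)
  symm := ⟨fun _ _ h => ⟨h.1.symm, h.2.symm⟩⟩
  loopless := ⟨fun _ h => h.1 rfl⟩

theorem exists_separating_shift {J ι : Type*} [Finite J] [Finite ι] (y r : J → ι → ℝ) :
    ∃ h : J → ℝ, ∀ j j', j ≠ j' → ∀ i i',
      (r j i + r j' i') ^ 2 < ((y j i + h j) - (y j' i' + h j')) ^ 2 := by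
  obtain ⟨n, ⟨e⟩⟩ := Finite.exists_equiv_fin J
  obtain ⟨K, hK⟩ := (Set.finite_range (fun q : J × ι => |y q.1 q.2| + |r q.1 q.2|)).bddAbove
  refine ⟨fun j => (2 * K + 1) * ((e j : ℕ) : ℝ), fun j j' hne i i' => ?_⟩
  have h1 : |y j i| + |r j i| ≤ K := hK ⟨(j, i), rfl⟩
  have h2 : |y j' i'| + |r j' i'| ≤ K := hK ⟨(j', i'), rfl⟩
  have hn : (1 : ℝ) ≤ |((e j : ℕ) : ℝ) - ((e j' : ℕ) : ℝ)| := by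
    have : ((e j : ℕ) : ℤ) - ((e j' : ℕ) : ℤ) ≠ 0 := by
      intro h
      exact hne (e.injective (Fin.ext (by omega)))
    exact_mod_cast Int.one_le_abs this
  rw [sq_lt_sq]
  have hK0 : 0 ≤ K := by linarith [abs_nonneg (y j i), abs_nonneg (r j i)]
  have h3 := abs_add_le (r j i) (r j' i')
  have h4 : 2 * K + 1 ≤ |(2 * K + 1) * (((e j : ℕ) : ℝ) - ((e j' : ℕ) : ℝ))| := by
    rw [abs_mul, abs_of_pos (by linarith : 0 < 2 * K + 1)]
    nlinarith
  have h5 : |(2 * K + 1) * (((e j : ℕ) : ℝ) - ((e j' : ℕ) : ℝ))| ≤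
      |(y j i + (2 * K + 1) * ((e j : ℕ) : ℝ)) - (y j' i' + (2 * K + 1) * ((e j' : ℕ) : ℝ))| +
        (|y j i| + |y j' i'|) := by
    have : (2 * K + 1) * (((e j : ℕ) : ℝ) - ((e j' : ℕ) : ℝ)) =
      ((y j i + (2 * K + 1) * ((e j : ℕ) : ℝ)) - (y j' i' + (2 * K + 1) * ((e j' : ℕ) : ℝ))) +
        (-y j i + y j' i') := by ring
    rw [this]
    refine (abs_add_le _ _).trans ?_
    have := abs_add_le (-y j i) (y j' i')
    rw [abs_neg] at this
    linarith
  linarith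

/-- Circles whose centres differ in one coordinate by more than the sum of the radii are disjoint.
-/
theorem sq_ne_of_far {c R R' D E : ℝ} (hc : 0 ≤ c) (hc1 : c < 1) (hR : 0 < R) (hR' : 0 < R')
    (h : (R + R') ^ 2 < D ^ 2) : (R ^ 2 + R' ^ 2 - E ^ 2 - D ^ 2) ^ 2 ≠ 4 * c ^ 2 * R ^ 2 * R' ^ 2 := by
  have h5 : 0 < R * R' := mul_pos hR hR'
  have h4 : 2 * (R * R') < D ^ 2 + E ^ 2 - R ^ 2 - R' ^ 2 := by
    have := sq_nonneg E
    linarith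
  have hlt : (2 * (R * R')) ^ 2 < (D ^ 2 + E ^ 2 - R ^ 2 - R' ^ 2) ^ 2 :=
    pow_lt_pow_left₀ h4 (by positivity) two_ne_zero
  have hc2 : c ^ 2 ≤ 1 := pow_le_one₀ hc hc1.le
  have := mul_le_mul_of_nonneg_right hc2 (sq_nonneg (2 * (R * R')))
  refine ne_of_gt ?_
  calc 4 * c ^ 2 * R ^ 2 * R' ^ 2 = c ^ 2 * (2 * (R * R')) ^ 2 := by ring
    _ < (D ^ 2 + E ^ 2 - R ^ 2 - R' ^ 2) ^ 2 := by linarith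
    _ = _ := by ring

/-- There is a finite system of circles whose `AngleRel c` graph has no cycle of length less than
`g` and no `k`-colouring; moreover the circles are in general position with respect to their first
coordinates. -/
def HasUncolorableSystem (c : ℝ) (g k : ℕ) : Prop :=
  ∃ (ι : Type) (_ : Fintype ι) (x y r : ι → ℝ), (∀ i, 0 < r i) ∧
    (∀ i j, i ≠ j → ∀ s ∈ ({-c, 0, c} : Finset ℝ), ∀ t ∈ ({-c, 0, c} : Finset ℝ),
      x i + s * r i ≠ x j + t * r j) ∧
    (angleGraph c x y r).EdgeSparse g ∧ ¬ (angleGraph c x y r).Colorable k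

theorem HasUncolorableSystem.succ {c : ℝ} (hc : 0 ≤ c) (hc1 : c < 1) {g k : ℕ}
    (h : HasUncolorableSystem c g k) : HasUncolorableSystem c g (k + 1) := by
  classical
  obtain ⟨ι, _, x, y, r, hr, hgen, hsp, hcol⟩ := h
  let X : Finset ℝ := Finset.univ.image (fun i => x i + c * r i) ∪
    Finset.univ.image (fun i => x i + -c * r i)
  obtain ⟨J, _, b, l, hl, hJsp, hJcol⟩ := sparseGallai g X (k + 1)
  let O := {o // o ∈ (Finset.univ ×ˢ X).image (fun q : J × ℝ => b q.1 + l q.1 * q.2)}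
  have : Fintype O := Finset.fintypeCoeSort _
  obtain ⟨h, hh⟩ := exists_separating_shift (fun j i => l j * y i) (fun j i => |l j| * r i)
  -- Coefficients of a (X² + Y²) - 2 p X - 2 q Y + d = 0. Here `inl o` is the line X = o, and `inr
  -- (j, i)` is circle `i` scaled by `l j`, possibly negative, and shifted by (b j, h j).
  let a : O ⊕ (J × ι) → ℝ := Sum.elim (fun _ => 0) (fun _ => 1)
  let p : O ⊕ (J × ι) → ℝ := Sum.elim (fun _ => 1) (fun q => b q.1 + l q.1 * x q.2)
  let q : O ⊕ (J × ι) → ℝ := Sum.elim (fun _ => 0) (fun q => l q.1 * y q.2 + h q.1)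
  let ρ : O ⊕ (J × ι) → ℝ := Sum.elim (fun _ => 1) (fun q => |l q.1| * r q.2)
  let d : O ⊕ (J × ι) → ℝ := Sum.elim (fun o => 2 * o.1) (fun v =>
    p (Sum.inr v) ^ 2 + q (Sum.inr v) ^ 2 - ρ (Sum.inr v) ^ 2)
  have hlr : ∀ j i, 0 < |l j| * r i := fun j i => mul_pos (abs_pos.2 (hl j)) (hr i)
  obtain ⟨x', y', r', hr', hgen', hrel⟩ := exists_generic_inversion (S := {-c, 0, c})
    (a := a) (p := p) (q := q) (d := d) (ρ := ρ)
    (by intro s hs; simp at hs ⊢; rcases hs with rfl | rfl | rfl <;> simp)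
    (by intro s hs; simp at hs; rcases hs with rfl | rfl | rfl <;> linarith)
    (by rintro (o | ⟨j, i⟩); exacts [one_pos, hlr j i])
    (by rintro (o | v) <;> simp [a, d]; simp [p, q, ρ])
    (by rintro (o | v) <;> simp [a, p, q, ρ])
    (by
      rintro (o | ⟨j, i⟩) (o' | ⟨j', i'⟩) hne hv hw
      · simp [a] at hv
      · simp [a] at hv
      · simp [a] at hw
      · by_cases hj : j = j'
        · subst hj
          left
          have hi : i ≠ i' := fun h => hne (by rw [h])
          have := hgen i i' hi 0 (by simp) 0 (by simp)
          intro heq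
          simp only [p, Sum.elim_inr] at heq
          exact this (by simpa using mul_left_cancel₀ (hl j) (add_left_cancel heq))
        · right
          intro heq
          have := hh j j' hj i i'
          simp only [q, Sum.elim_inr] at heq
          rw [heq, sub_self] at this
          nlinarith [sq_nonneg (|l j| * r i + |l j'| * r i')])
    (by
      rintro (o | v) (o' | v') hne hv hw
      · intro heq
        simp only [d, Sum.elim_inl] at heq
        exact hne (congrArg Sum.inl (Subtype.ext (by linarith)))
      · simp [a] at hw
      · simp [a] at hv
      · simp [a] at hv)
  have hOO : ∀ o o' : O, ¬ (angleGraph c x' y' r').Adj (Sum.inl o) (Sum.inl o') := by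
    rintro o o' ⟨-, hadj⟩
    rw [hrel] at hadj
    simp [a, p, q, ρ] at hadj
    -- For parallel lines the relation amounts to c² = 1.
    nlinarith
  have hcc : ∀ j i j' i', (angleGraph c x' y' r').Adj (Sum.inr (j, i)) (Sum.inr (j', i')) ↔
      j = j' ∧ (angleGraph c x y r).Adj i i' := by
    intro j i j' i'
    have hid : 2 * (p (Sum.inr (j, i)) * p (Sum.inr (j', i')) +
        q (Sum.inr (j, i)) * q (Sum.inr (j', i'))) -
        a (Sum.inr (j, i)) * d (Sum.inr (j', i')) - a (Sum.inr (j', i')) * d (Sum.inr (j, i)) =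
        (|l j| * r i) ^ 2 + (|l j'| * r i') ^ 2 - ((b j + l j * x i) - (b j' + l j' * x i')) ^ 2 -
          ((l j * y i + h j) - (l j' * y i' + h j')) ^ 2 := by
      simp only [a, p, q, d, ρ, Sum.elim_inr]; ring
    have hρ : ∀ j i, ρ (Sum.inr (j, i)) = |l j| * r i := fun _ _ => rfl
    constructor
    · rintro ⟨hne, hadj⟩
      rw [hrel, hid, hρ, hρ] at hadj
      have hj : j = j' := by
        by_contra hj
        exact sq_ne_of_far hc hc1 (hlr j i) (hlr j' i') (hh j j' hj i i') hadj
      subst hj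
      refine ⟨rfl, fun h => hne (by rw [h]), ?_⟩
      have hl4 : l j ^ 4 ≠ 0 := pow_ne_zero _ (hl j)
      refine mul_left_cancel₀ hl4 ?_
      rw [mul_pow, mul_pow, sq_abs] at hadj
      linear_combination hadj
    · rintro ⟨rfl, hne, hadj⟩
      refine ⟨fun h => hne (Prod.mk.inj (Sum.inr.inj h)).2, ?_⟩
      rw [hrel, hid, hρ, hρ, mul_pow, mul_pow, sq_abs]
      unfold AngleRel at hadj
      linear_combination l j ^ 4 * hadj
  have hOc : ∀ o j i, (angleGraph c x' y' r').Adj (Sum.inl o) (Sum.inr (j, i)) ↔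
      (o : ℝ) = b j + l j * (x i + c * r i) ∨ (o : ℝ) = b j + l j * (x i + -c * r i) := by
    intro o j i
    have : (angleGraph c x' y' r').Adj (Sum.inl o) (Sum.inr (j, i)) ↔
        AngleRel c (x' (Sum.inl o)) (y' (Sum.inl o)) (r' (Sum.inl o)) (x' (Sum.inr (j, i)))
          (y' (Sum.inr (j, i))) (r' (Sum.inr (j, i))) := ⟨fun h => h.2, fun h => ⟨by simp, h⟩⟩
    rw [this, hrel]
    simp only [a, p, q, d, ρ, Sum.elim_inl, Sum.elim_inr, mul_pow, sq_abs]
    -- The relation reads (o - b - l x)² = c² l² r², a difference of squares.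
    have hfac : (o : ℝ) = b j + l j * (x i + c * r i) ∨ (o : ℝ) = b j + l j * (x i + -c * r i) ↔
        ((o : ℝ) - (b j + l j * (x i + c * r i))) * ((o : ℝ) - (b j + l j * (x i + -c * r i))) = 0 := by
      rw [mul_eq_zero, sub_eq_zero, sub_eq_zero]
    rw [hfac]
    constructor
    · intro h
      linear_combination h / 4
    · intro h
      linear_combination 4 * h
  have hXmem : ∀ x₀ ∈ X, ∃ i, ∃ s, (s = c ∨ s = -c) ∧ x₀ = x i + s * r i := by
    intro x₀ hx₀
    rcases Finset.mem_union.1 hx₀ with hx | hx <;> obtain ⟨i, -, rfl⟩ := Finset.mem_image.1 hx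
    · exact ⟨i, c, Or.inl rfl, rfl⟩
    · exact ⟨i, -c, Or.inr rfl, rfl⟩
  have hXc : ∀ i, x i + c * r i ∈ X := fun i =>
    Finset.mem_union_left _ (Finset.mem_image_of_mem _ (Finset.mem_univ i))
  have hXc' : ∀ i, x i + -c * r i ∈ X := fun i =>
    Finset.mem_union_right _ (Finset.mem_image_of_mem (fun i => x i + -c * r i) (Finset.mem_univ i))
  refine ⟨O ⊕ (J × ι), inferInstance, x', y', r', hr', hgen', ?_, ?_⟩
  · refine SimpleGraph.EdgeSparse.amalgam (G := angleGraph c x y r)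
      (fun j o i => (o : ℝ) = b j + l j * (x i + c * r i) ∨ (o : ℝ) = b j + l j * (x i + -c * r i))
      hOO (fun j i j' i' => (hcc j i j' i').1) (fun o j i => (hOc o j i).1) ?_ ?_ hsp
    -- General position with s, t = ±c: a line is attached to at most one circle of each copy.
    · intro j o i i' h1 h2
      by_contra hne
      have aux : ∀ i, ((o : ℝ) = b j + l j * (x i + c * r i) ∨
          (o : ℝ) = b j + l j * (x i + -c * r i)) →
          ∃ s ∈ ({-c, 0, c} : Finset ℝ), (o : ℝ) = b j + l j * (x i + s * r i) := by
        rintro i (h | h)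
        · exact ⟨c, by simp, h⟩
        · exact ⟨-c, by simp, h⟩
      obtain ⟨s, hs, h1⟩ := aux i h1
      obtain ⟨t, ht, h2⟩ := aux i' h2
      exact hgen i i' hne s hs t ht
        (mul_left_cancel₀ (hl j) (add_left_cancel (h1.symm.trans h2)))
    · intro F h2 hg
      have hinj : Function.Injective (Subtype.val : O → ℝ) := Subtype.val_injective
      obtain ⟨e, he, f, hf, hne, h1, h2⟩ := hJsp F h2 hg
      have hin : ∀ (o : O) j, (∃ i, (o : ℝ) = b j + l j * (x i + c * r i) ∨
          (o : ℝ) = b j + l j * (x i + -c * r i)) →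
          (o : ℝ) ∈ (fun x => b j + l j * x) '' (X : Set ℝ) := by
        rintro o j ⟨i, h | h⟩
        · exact ⟨_, hXc i, h.symm⟩
        · exact ⟨_, hXc' i, h.symm⟩
      have pull : ∀ e, IsEar (fun j => (fun x => b j + l j * x) '' (X : Set ℝ)) F e →
          IsEar (fun j => {o : O | ∃ i, (o : ℝ) = b j + l j * (x i + c * r i) ∨
            (o : ℝ) = b j + l j * (x i + -c * r i)}) F e := by
        rintro e hear o ho o' ho' ⟨f, hf, hfe, hof⟩ ⟨f', hf', hfe', hof'⟩
        exact hinj (hear o (hin o e ho) o' (hin o' e ho') ⟨f, hf, hfe, hin o f hof⟩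
          ⟨f', hf', hfe', hin o' f' hof'⟩)
      exact ⟨e, he, f, hf, hne, pull e h1, pull f h2⟩
  · rintro ⟨C⟩
    -- The colour 0 away from the chosen lines is arbitrary, since every copy of `X` lies in `O`.
    obtain ⟨j, κ, hκ⟩ := hJcol (fun o => if ho : o ∈ (Finset.univ ×ˢ X).image
      (fun q : J × ℝ => b q.1 + l q.1 * q.2) then C (Sum.inl ⟨o, ho⟩) else 0)
    have hO : ∀ x₀ ∈ X, b j + l j * x₀ ∈ (Finset.univ ×ˢ X).image
        (fun q : J × ℝ => b q.1 + l q.1 * q.2) := fun x₀ hx₀ =>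
      Finset.mem_image.2 ⟨(j, x₀), by simp [hx₀], rfl⟩
    have hne : ∀ i, C (Sum.inr (j, i)) ≠ κ := by
      intro i heq
      have h1 := hκ _ (hXc i)
      rw [dif_pos (hO _ (hXc i)), ← heq] at h1
      exact C.valid ((hOc ⟨_, hO _ (hXc i)⟩ j i).2 (Or.inl rfl)) h1
    apply hcol
    -- The circles of copy `j` avoid `κ`, which leaves k colours.
    let C' : (angleGraph c x y r).Coloring {z : Fin (k + 1) // z ≠ κ} :=
      SimpleGraph.Coloring.mk (fun i => ⟨C (Sum.inr (j, i)), hne i⟩) (by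
        intro i i' hadj heq
        exact C.valid ((hcc j i j i').2 ⟨rfl, hadj⟩) (congrArg Subtype.val heq))
    have := C'.colorable
    rwa [Fintype.card_subtype_compl, Fintype.card_fin, Fintype.card_subtype_eq,
      Nat.add_sub_cancel] at this

theorem hasUncolorableSystem {c : ℝ} (hc : 0 ≤ c) (hc1 : c < 1) (g k : ℕ) :
    HasUncolorableSystem c g k := by
  induction k with
  | zero =>
    refine ⟨Unit, inferInstance, fun _ => 0, fun _ => 0, fun _ => 1, fun _ => one_pos,
      fun i j h => absurd rfl h, ?_, ?_⟩
    · intro F hF h2 _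
      obtain ⟨e, he, -⟩ := Finset.one_lt_card.1 h2
      have := hF e he
      induction e using Sym2.ind with
      | _ u v => exact absurd rfl this.1
    · rw [SimpleGraph.colorable_zero_iff]
      exact fun h => h.false ()
  | succ k ih => exact ih.succ hc hc1

theorem mainTheorem6 (θ : ℝ) (hθ : θ ∈ Set.Ioc 0 (Real.pi / 2)) (g k : ℕ) (hg : 3 ≤ g)
    (hk : 1 ≤ k) :
    ∃ 𝒞 : Set (EuclideanGeometry.Sphere Plane),
      𝒞.Finite ∧
      (∀ C ∈ 𝒞, 0 < C.radius) ∧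
      (∀ C₁ ∈ 𝒞, ∀ C₂ ∈ 𝒞, C₁ ≠ C₂ → C₁.center ≠ C₂.center) ∧
      (g : ℕ∞) ≤ (thetaGraph θ 𝒞).egirth ∧
      (k : ℕ∞) ≤ (thetaGraph θ 𝒞).chromaticNumber := by
  have hc : 0 ≤ Real.cos θ := Real.cos_nonneg_of_mem_Icc ⟨by linarith [hθ.1, Real.pi_pos], hθ.2⟩
  have hc1 : Real.cos θ < 1 := by
    rw [← Real.cos_zero]
    exact Real.cos_lt_cos_of_nonneg_of_le_pi_div_two le_rfl hθ.2 hθ.1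
  obtain ⟨ι, _, x, y, r, hr, hgen, hsp, hcol⟩ := hasUncolorableSystem hc hc1 g k
  let f : ι → EuclideanGeometry.Sphere Plane := fun i => ⟨!₂[x i, y i], r i⟩
  have hcen : ∀ i j, (f i).center = (f j).center → i = j := by
    intro i j h
    by_contra hne
    have h0 : x i = x j := by simpa [f] using congrArg (fun v : Plane => v 0) h
    exact hgen i j hne 0 (by simp) 0 (by simp) (by rw [h0]; ring)
  have hf : Function.Injective f := fun i j h => hcen i j (by rw [h])
  let E : ι ≃ Set.range f := Equiv.ofInjective f hf
  have hadj : ∀ i j, (thetaGraph θ (Set.range f)).Adj (E i) (E j) ↔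
      (angleGraph (Real.cos θ) x y r).Adj i j := by
    intro i j
    have : IntersectAtAngle θ (f i) (f j) ↔
        AngleRel (Real.cos θ) (x i) (y i) (r i) (x j) (y j) (r j) := by
      rw [intersectAtAngle_iff hθ (hr i) (hr j)]
      simp [f]
    exact and_congr E.injective.ne_iff this
  let φ : angleGraph (Real.cos θ) x y r ≃g thetaGraph θ (Set.range f) := ⟨E, hadj _ _⟩
  refine ⟨Set.range f, Set.finite_range f, ?_, ?_, ?_, ?_⟩
  · rintro _ ⟨i, rfl⟩
    exact hr i
  · rintro _ ⟨i, rfl⟩ _ ⟨j, rfl⟩ hne hcc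
    exact hne (by rw [hcen i j hcc])
  · refine SimpleGraph.le_egirth.2 fun a w hw => ?_
    have := SimpleGraph.le_egirth.1 hsp.le_egirth _ (w.map φ.symm.toHom)
      (hw.map φ.symm.injective)
    rwa [SimpleGraph.Walk.length_map] at this
  · by_contra hlt
    rw [not_le] at hlt
    have := SimpleGraph.chromaticNumber_le_iff_colorable.1 hlt.le
    exact hcol (this.of_hom φ.toHom)
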